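/- Let $n\ge 1$ and $[n]=\{1,\dots,n\}$, arranged on a circle. For $i\in[n]$ let $<_i$ be the total order $i<_i i+1<_i\cdots<_i n<_i 1<_i\cdots<_i i-1$. For $a,b\in[n]$ let $[a,b]=\{x: x\le_a b\}$ be the cyclic interval from $a$ to $b$, and let $(b,a)=[n]\setminus[a,b]$. A Grassmann necklace of type $(d,n)$ is a sequence $\mathcal I=(I_1,\dots,I_n)$ of $d$-subsets of $[n]$ such that, with $I_{n+1}=I_1$, for each $i$: if $i\in I_i$ then $I_{i+1}=(I_i\setminus\{i\})\cup\{j\}$ for some $j\in[n]$, and if $i\notin I_i$ then $I_{i+1}=I_i$. Let $\mathcal M$ be the positroid of rank $d$ on $[n]$ with Grassmann necklace $\mathcal I$, that is, the matroid whose bases are the $d$-subsets $B$ of $[n]$ such that, for every $j\in[n]$ and every $k\le d$, the $k$-th smallest element of $I_j$ in the order $<_j$ is $\le_j$ the $k$-th smallest element of $B$. Assume that $\mathcal M$ has no loops and no coloops. For $X\subseteq[n]$ let $\mathrm{rk}(X)$ be the rank of $X$ in $\mathcal M$, put $\mathrm{rk}(\mathcal M)=\mathrm{rk}([n])$, and let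 $\mathrm{minelts}(b,a)$ be the smallest number of elements that a basis of $\mathcal M$ can have in $(b,a)$. Let $E=[a_1,b_1]\cup\cdots\cup[a_s,b_s]$ be a disjoint union of $s$ cyclic intervals, where $a_1,b_1,a_2,b_2,\dots,a_s,b_s$ are cyclically ordered ($a_i=b_i$ being allowed), i.e. $a_1\le_c b_1<_c a_2\le_c b_2<_c\cdots<_c a_s\le_c b_s$ for some $c\in[n]$. For a non-empty set $T=\{t_1<\cdots<t_m\}\subseteq[s]$ put $E|_T=\bigcup_{t\in T}[a_t,b_t]$ and $$\mathrm{nbd}(E|_T)=\mathrm{rk}(\mathcal M)-\sum_{k=1}^m \mathrm{minelts}(b_{t_k},a_{t_{k+1}}),\qquad t_{m+1}=t_1 .$$ For a partition $\Pi$ of $[s]$ put $\mathrm{nbd}(E,\Pi)=\sum_{T\in\Pi}\mathrm{nbd}(E|_T)$. The partition $\Pi$ is non-crossing if there are no cyclically ordered $w,x,y,z\in[s]$ such that $w,y$ lie in one block of $\Pi$ and $x,z$ lie in a different block. Then: 1. $\mathrm{rk}(E)=\mathrm{nbd}(E,\Pi)$ for some non-crossing partition $\Pi$ of $[s]$. 2.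 $\mathrm{rk}(E)\le\mathrm{nbd}(E,\Pi)$ for every non-crossing partition $\Pi$ of $[s]$; hence $\mathrm{rk}(E)=\min_\Pi \mathrm{nbd}(E,\Pi)$ over all non-crossing partitions $\Pi$ of $[s]$. 3. There is exactly one decorated permutation $\pi$ (a bijection of $[n]$ whose fixed points are coloured black or white) such that, for every $k\in[n]$, $I_k$ is the set of those $j$ for which $j<_k\pi^{-1}(j)$ or $j$ is a black fixed point. It has no fixed points. For $X\subseteq[n]$ let $\mathrm{cw}(X)$ be the number of $x\in[n]$ with $[x,\pi(x)]\subseteq X$ and $\mathrm{ccw}(X)$ the number of $x\in[n]$ with $[x,\pi^{-1}(x)]\subseteq X$. Then for every non-empty $T=\{t_1<\cdots<t_m\}\subseteq[s]$, $$\mathrm{nbd}(E|_T)=\mathrm{rk}(\mathcal M)-\sum_{k=1}^m\mathrm{ccw}\bigl((b_{t_k},a_{t_{k+1}})\bigr),\qquad t_{m+1}=t_1,$$ and for every $i\in[s]$ with $[a_i,b_i]\neq[n]$, $$\mathrm{nbd}(E|_{\{i\}})=|[a_i,b_i]|-\mathrm{cw}([a_i,b_i]).$$ -/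

import Mathlib

namespace Positroid

/-! ### The cyclically shifted orders and cyclic intervals

The ground set `[n]` is `Fin n`, whose subtraction is modulo `n`, so that `x - i` is the position
of `x` in the list `i, i + 1, …, n, 1, …, i - 1`. -/

/-- `x ≤ y` in the cyclically shifted order starting at `i`. -/
def cycLE {n : ℕ} (i x y : Fin n) : Prop := x - i ≤ y - i

/-- `x < y` in the cyclically shifted order starting at `i`. -/
def cycLT {n : ℕ} (i x y : Fin n) : Prop := x - i < y - i

/-- The cyclic interval `[a, b]`. -/
def cycIcc {n : ℕ} (a b : Fin n) : Set (Fin n) := {x | cycLE a x b}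

/-- The open cyclic interval `(b, a)`: the elements strictly after `b` and strictly before `a`,
going around the circle. It is the complement of `[a, b]`; in particular `(a, a)` consists of all
elements other than `a`. -/
def cycIoo {n : ℕ} (b a : Fin n) : Set (Fin n) := (cycIcc a b)ᶜ

/-! ### Gale orders, Grassmann necklaces, positroids -/

/-- The Gale order `S ≤ T` with respect to the cyclically shifted order starting at `i`: the `j`-th
smallest element of `S` is at most the `j`-th smallest element of `T`, for every `j`. (The two
sets must have the same size.) -/
def galeLE {n : ℕ} (i : Fin n) (S T : Finset (Fin n)) : Prop :=
  List.Forall₂ (fun x y : Fin n => x ≤ y)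
    ((S.image (fun x => x - i)).sort) ((T.image (fun x => x - i)).sort)

/-- `I` is a Grassmann necklace of type `(d, n)`. -/
structure IsGrassmannNecklace {n : ℕ} [NeZero n] (d : ℕ) (I : Fin n → Finset (Fin n)) : Prop where
  card_eq : ∀ i, (I i).card = d
  step_mem : ∀ i, i ∈ I i → ∃ j, I (i + 1) = insert j (I i \ {i})
  step_notMem : ∀ i, i ∉ I i → I (i + 1) = I i

/-- `M` is the positroid of rank `d` on the ground set `[n]` with Grassmann necklace `I`: its bases
are the `d`-subsets `B` of `[n]` with `I j ≤ B` in the `j`-th Gale order, for all `j`. -/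
structure IsPositroidOf {n : ℕ} [NeZero n] (d : ℕ) (I : Fin n → Finset (Fin n))
    (M : Matroid (Fin n)) : Prop where
  necklace : IsGrassmannNecklace d I
  ground_eq : M.E = Set.univ
  isBase_iff : ∀ B : Finset (Fin n),
    M.IsBase (B : Set (Fin n)) ↔ B.card = d ∧ ∀ j, galeLE j (I j) B

/-! ### Decorated permutations and arrows -/

/-- A decorated permutation of `[n]`: a bijection with its fixed points coloured black or white
(`black` is the set of the black ones). -/
structure DecoratedPermutation (n : ℕ) where
  perm : Equiv.Perm (Fin n)
  black : Set (Fin n)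
  perm_eq_of_mem_black : ∀ j ∈ black, perm j = j

/-- `j` is a weak `i`-exceedance of `π`. -/
def DecoratedPermutation.IsWeakExceedance {n : ℕ} (π : DecoratedPermutation n) (i j : Fin n) :
    Prop :=
  cycLT i j (π.perm.symm j) ∨ j ∈ π.black

/-- `π` is the decorated permutation of the Grassmann necklace `I`: every `I k` is the set of
weak `k`-exceedances of `π`. -/
def DecoratedPermutation.IsAssociatedTo {n : ℕ} (π : DecoratedPermutation n)
    (I : Fin n → Finset (Fin n)) : Prop :=
  ∀ k j, j ∈ I k ↔ π.IsWeakExceedance k j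

/-- The number of CW-arrows `[x, π x]` contained in `T`. -/
noncomputable def DecoratedPermutation.cw {n : ℕ} (π : DecoratedPermutation n)
    (T : Set (Fin n)) : ℕ :=
  {x : Fin n | cycIcc x (π.perm x) ⊆ T}.ncard

/-- The number of CCW-arrows `[x, π⁻¹ x]` contained in `T`. -/
noncomputable def DecoratedPermutation.ccw {n : ℕ} (π : DecoratedPermutation n)
    (T : Set (Fin n)) : ℕ :=
  {x : Fin n | cycIcc x (π.perm.symm x) ⊆ T}.ncard

/-! ### Disjoint unions of cyclic intervals, non-crossing partitions, rank bounds -/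

/-- The list `a 0, b 0, a 1, b 1, …, a (s - 1), b (s - 1)` is cyclically ordered, where
`a i = b i` is allowed (the interval `[a i, b i]` may be a single point). -/
def CyclicallyOrdered {n s : ℕ} (a b : Fin s → Fin n) : Prop :=
  ∃ c : Fin n, (∀ i, cycLE c (a i) (b i)) ∧ ∀ i j, i < j → cycLT c (b i) (a j)

/-- The partition `P` of `[s]` is non-crossing. -/
def IsNonCrossing {s : ℕ} (P : Finpartition (Finset.univ : Finset (Fin s))) : Prop :=
  ∀ T ∈ P.parts, ∀ U ∈ P.parts, T ≠ U →
    ¬ ∃ i w x y z : Fin s, cycLT i w x ∧ cycLT i x y ∧ cycLT i y z ∧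
      w ∈ T ∧ y ∈ T ∧ x ∈ U ∧ z ∈ U

/-- The rank of a set, as a natural number. -/
noncomputable def rk {n : ℕ} (M : Matroid (Fin n)) (X : Set (Fin n)) : ℕ := (M.eRk X).toNat

/-- The minimal number of elements that a basis of `M` can have in `X`. -/
noncomputable def minElts {n : ℕ} (M : Matroid (Fin n)) (X : Set (Fin n)) : ℕ :=
  sInf {k : ℕ | ∃ B, M.IsBase B ∧ (B ∩ X).ncard = k}

/-- The natural rank bound of `[a 0, b 0] ∪ ⋯ ∪ [a (m - 1), b (m - 1)]`: the rank of `M` minus the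
sum over the `m` gaps `(b i, a (i + 1))` (indices modulo `m`) of the minimal number of elements of
a basis in the gap. -/
noncomputable def nbd {n m : ℕ} (M : Matroid (Fin n)) (a b : Fin m → Fin n) : ℤ :=
  (rk M M.E : ℤ) - ∑ i : Fin m, (minElts M (cycIoo (b i) (a (finRotate m i))) : ℤ)

/-- The subfamily indexed by the block `T`, in increasing order of the indices. -/
def restrictBlock {n s : ℕ} (a : Fin s → Fin n) (T : Finset (Fin s)) : Fin T.card → Fin n :=
  fun k => a (T.orderEmbOfFin rfl k)

/-- The sum over the blocks of `P` of the natural rank bounds of the unions of the intervals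
indexed by the blocks. -/
noncomputable def nbdPartition {n s : ℕ} (M : Matroid (Fin n)) (a b : Fin s → Fin n)
    (P : Finpartition (Finset.univ : Finset (Fin s))) : ℤ :=
  ∑ T ∈ P.parts, nbd M (restrictBlock a T) (restrictBlock b T)

end Positroid

namespace Positroid

open Finset

/-! ### Arithmetic of cyclic positions -/

/-! Upper bound. A basis meeting `E|_T` in `rk(E|_T)` elements still has at least `minelts` elements
in every gap, and the intervals and gaps partition the circle; so `rk(E|_T) ≤ nbd(E|_T)`.
Subadditivity of rank over the blocks gives the bound for any partition.

Attainment. Fix a basis `B` with `|B ∩ E| = rk(E)` and call `X` tight if `|B ∩ X| = rk(X)`. The main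
point (`exists_tight_perm`) is a permutation `σ` of `[s]` with every `[a_t, b_{σ t}]` tight. Were
Hall's condition to fail on a set of starting points, one could lower the prefix counts of `B` there
by 1, lose at most 1 at each of the fewer neighbouring end points, and extend these values by a
shortest-path formula. Positroid bases are cut out by bounds on cyclic intervals, so the result is
again the prefix count of a basis (`exists_isBase_of_potential`), which meets `E` in more elements
than `B`.

By submodularity tight sets are closed under intersection and union, so crossing arcs `t → σ t` can
be uncrossed (`exists_noncrossing_perm`). The cycles of the resulting `σ` form a non-crossing
partition, and `σ` sends each index to its cyclic predecessor in its block. Hence every gap of a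
block is the complement of a tight interval, `B` is minimal in it, and `nbd(E|_T) = |B ∩ E|_T|`.
Summing over blocks gives `rk(E)`.

Arrows. Without loops and coloops, each step of the necklace exchanges `i ∈ I_i` for a new element,
which is `π(i)`. Each `I_a` is a basis that is maximal on `[a, b]` and minimal on `(b, a)` for all
`b`; its elements in `(b, a)` are the starts of the CCW-arrows there, and its non-elements in a
proper `[a, b]` are the heads of the CW-arrows there. -/

theorem val_sub_eq_ite {n : ℕ} (x i : Fin n) :
    (x - i).val = if i.val ≤ x.val then x.val - i.val else n + x.val - i.val := by
  have hx := x.isLt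
  have hi := i.isLt
  have hsub : (x - i).val = (n - i.val + x.val) % n := by rw [Fin.sub_def]
  rw [hsub]
  split_ifs with h
  · rw [show n - i.val + x.val = (x.val - i.val) + n by omega, Nat.add_mod_right,
      Nat.mod_eq_of_lt (by omega)]
  · rw [show n - i.val + x.val = n + x.val - i.val by omega]
    exact Nat.mod_eq_of_lt (by omega)

/-- Change of origin: once all positions are measured from one point `z`, cyclic statements become
linear integer arithmetic. -/
theorem val_sub_rebase {n : ℕ} (z x y : Fin n) :
    (x - y).val = if (y - z).val ≤ (x - z).val then (x - z).val - (y - z).val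
      else n + (x - z).val - (y - z).val := by
  have hx := x.isLt
  have hy := y.isLt
  have hz := z.isLt
  simp only [val_sub_eq_ite]
  split_ifs <;> omega

theorem val_sub_inj {n : ℕ} {z x y : Fin n} (h : (x - z).val = (y - z).val) : x = y := by
  have hx := x.isLt
  have hy := y.isLt
  have hz := z.isLt
  simp only [val_sub_eq_ite] at h
  apply Fin.ext
  split_ifs at h <;> omega

theorem val_sub_self {n : ℕ} (x : Fin n) : (x - x).val = 0 := by
  simp [val_sub_eq_ite]

theorem mem_cycIcc_iff {n : ℕ} {a b x : Fin n} :
    x ∈ cycIcc a b ↔ (x - a).val ≤ (b - a).val := Iff.rfl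

theorem mem_cycIoo_iff {n : ℕ} {a b x : Fin n} :
    x ∈ cycIoo b a ↔ (b - a).val < (x - a).val := by
  rw [cycIoo, Set.mem_compl_iff, mem_cycIcc_iff, not_le]

theorem mem_cycIcc_iff_rebase {n : ℕ} (c : Fin n) {a b x : Fin n} :
    x ∈ cycIcc a b ↔ if (a - c).val ≤ (b - c).val
      then (a - c).val ≤ (x - c).val ∧ (x - c).val ≤ (b - c).val
      else (a - c).val ≤ (x - c).val ∨ (x - c).val ≤ (b - c).val := by
  have h1 := (a - c).isLt
  have h2 := (b - c).isLt
  have h3 := (x - c).isLt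
  rw [mem_cycIcc_iff, val_sub_rebase c x a, val_sub_rebase c b a]
  split_ifs <;> omega

/-! ### The Gale order in terms of counts -/

theorem countP_le_of_forall₂ {α : Type*} [LinearOrder α] {l l' : List α}
    (h : List.Forall₂ (fun x y => x ≤ y) l l') (x : α) :
    l'.countP (fun y => y ≤ x) ≤ l.countP (fun y => y ≤ x) := by
  induction h with
  | nil => exact le_rfl
  | @cons s t l l' hst _ ih =>
    simp only [List.countP_cons, decide_eq_true_eq]
    split_ifs with h1 h2
    · omega
    · exact absurd (hst.trans h1) h2
    · omega
    · omega

theorem forall₂_le_iff_countP {α : Type*} [LinearOrder α] {l l' : List α}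
    (hl : l.Pairwise (· < ·)) (hl' : l'.Pairwise (· < ·)) :
    List.Forall₂ (fun x y => x ≤ y) l l' ↔ l.length = l'.length ∧
      ∀ x, l'.countP (fun y => y ≤ x) ≤ l.countP (fun y => y ≤ x) := by
  refine ⟨fun h => ⟨h.length_eq, countP_le_of_forall₂ h⟩, ?_⟩
  rintro ⟨hlen, hcount⟩
  induction l generalizing l' with
  | nil =>
    rw [List.eq_nil_of_length_eq_zero hlen.symm]
    exact .nil
  | cons s l ih =>
    cases l' with
    | nil => simp at hlen
    | cons t l' =>
      rw [List.pairwise_cons] at hl hl'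
      -- If `t < s`, the threshold `t` counts the head of the second list but nothing in the first.
      have hst : s ≤ t := by
        by_contra! hts
        have h := hcount t
        have h0 : l.countP (fun y => y ≤ t) = 0 := by
          rw [List.countP_eq_zero]
          intro y hy
          simpa using hts.trans (hl.1 y hy)
        simp [h0, not_le.mpr hts] at h
      refine .cons hst (ih hl.2 hl'.2 (by simpa using hlen) fun x => ?_)
      by_cases htx : t ≤ x
      · have h := hcount x
        simp only [List.countP_cons, htx, hst.trans htx, decide_true, if_true] at h
        omega
      · have h0 : l'.countP (fun y => y ≤ x) = 0 := by
          rw [List.countP_eq_zero]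
          intro y hy
          simpa using (not_le.mp htx).trans (hl'.1 y hy)
        omega

theorem countP_sort_image_sub {n : ℕ} (i x : Fin n) (S : Finset (Fin n)) :
    ((S.image (fun y => y - i)).sort).countP (fun y => y ≤ x - i) =
      ((S : Set (Fin n)) ∩ cycIcc i x).ncard := by
  classical
  have hinj : Function.Injective (fun y : Fin n => y - i) :=
    fun y y' h => val_sub_inj (congrArg Fin.val h)
  rw [← Multiset.coe_countP, Finset.sort_eq, Finset.image_val_of_injOn hinj.injOn,
    Multiset.countP_map, ← Finset.filter_val, Finset.card_val, ← Set.ncard_coe_finset]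
  congr 1
  ext y
  simp [cycIcc, cycLE]

theorem galeLE_iff {n : ℕ} (i : Fin n) (S T : Finset (Fin n)) :
    galeLE i S T ↔ S.card = T.card ∧
      ∀ x, ((T : Set (Fin n)) ∩ cycIcc i x).ncard ≤ ((S : Set (Fin n)) ∩ cycIcc i x).ncard := by
  classical
  have hinj : Function.Injective (fun y : Fin n => y - i) :=
    fun y y' h => val_sub_inj (congrArg Fin.val h)
  have hlt : ∀ U : Finset (Fin n), (U.sort).Pairwise (· < ·) := fun U =>
    (Finset.sortedLT_sort U).pairwise
  rw [galeLE, forall₂_le_iff_countP (hlt _) (hlt _), Finset.length_sort, Finset.length_sort,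
    Finset.card_image_of_injective _ hinj, Finset.card_image_of_injective _ hinj]
  refine and_congr_right fun _ => ⟨fun h x => ?_, fun h x => ?_⟩
  · simpa only [countP_sort_image_sub] using h (x - i)
  · have hx : x = (x + i) - i := by
      have : NeZero n := x.neZero
      simp
    rw [hx, countP_sort_image_sub, countP_sort_image_sub]
    exact h (x + i)

theorem IsPositroidOf.isBase_iff_ncard {n : ℕ} [NeZero n] {d : ℕ} {I : Fin n → Finset (Fin n)}
    {M : Matroid (Fin n)} (hM : IsPositroidOf d I M) (B : Set (Fin n)) :
    M.IsBase B ↔ B.ncard = d ∧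
      ∀ j x, (B ∩ cycIcc j x).ncard ≤ ((I j : Set (Fin n)) ∩ cycIcc j x).ncard := by
  classical
  have h := hM.isBase_iff B.toFinite.toFinset
  rw [Set.Finite.coe_toFinset, ← Set.ncard_eq_toFinset_card] at h
  rw [h]
  refine and_congr_right fun hB => forall_congr' fun j => ?_
  rw [galeLE_iff, Set.Finite.coe_toFinset, ← Set.ncard_eq_toFinset_card, hB, hM.necklace.card_eq]
  simp

/-! ### Ranks and bases -/

section Rank

variable {n : ℕ} (M : Matroid (Fin n))

theorem coe_rk (X : Set (Fin n)) : (rk M X : ℕ∞) = M.eRk X := by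
  rw [rk, ENat.natCast_toNat]
  have h := (M.eRk_le_encard X).trans_lt X.toFinite.encard_lt_top
  exact h.ne

theorem ncard_isBase_inter_le_rk {B : Set (Fin n)} (hB : M.IsBase B) (X : Set (Fin n)) :
    (B ∩ X).ncard ≤ rk M X := by
  have h : (B ∩ X).encard ≤ M.eRk X :=
    (hB.indep.subset Set.inter_subset_left).encard_le_eRk_of_subset Set.inter_subset_right
  rw [← coe_rk, ← (B ∩ X).toFinite.cast_ncard_eq] at h
  exact_mod_cast h

theorem exists_isBase_ncard_inter_eq_rk (X : Set (Fin n)) :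
    ∃ B, M.IsBase B ∧ (B ∩ X).ncard = rk M X := by
  obtain ⟨J, hJ⟩ := M.exists_isBasis' X
  obtain ⟨B, hB, hJB⟩ := hJ.indep.exists_isBase_superset
  refine ⟨B, hB, (ncard_isBase_inter_le_rk M hB X).antisymm ?_⟩
  have h := hJ.encard_eq_eRk
  rw [← coe_rk, ← J.toFinite.cast_ncard_eq] at h
  have h' : J.ncard = rk M X := by exact_mod_cast h
  rw [← h']
  exact Set.ncard_le_ncard (Set.subset_inter hJB hJ.subset)

theorem rk_inter_add_rk_union_le (X Y : Set (Fin n)) :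
    rk M (X ∩ Y) + rk M (X ∪ Y) ≤ rk M X + rk M Y := by
  have h := M.eRk_inter_add_eRk_union_le X Y
  simp only [← coe_rk] at h
  exact_mod_cast h

theorem ncard_inter_add_ncard_inter_compl (B X : Set (Fin n)) :
    (B ∩ X).ncard + (B ∩ Xᶜ).ncard = B.ncard := by
  rw [← Set.sdiff_eq]
  exact Set.ncard_inter_add_ncard_sdiff_eq_ncard B X

variable {M}

theorem ncard_eq_rk_ground {B : Set (Fin n)} (hB : M.IsBase B) : B.ncard = rk M M.E := by
  have h := hB.encard_eq_eRank
  rw [← M.eRk_ground, ← coe_rk, ← B.toFinite.cast_ncard_eq] at h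
  exact_mod_cast h

theorem minElts_le {B : Set (Fin n)} (hB : M.IsBase B) (X : Set (Fin n)) :
    minElts M X ≤ (B ∩ X).ncard :=
  Nat.sInf_le ⟨B, hB, rfl⟩

variable (M) in
theorem exists_isBase_ncard_inter_eq_minElts (X : Set (Fin n)) :
    ∃ B, M.IsBase B ∧ (B ∩ X).ncard = minElts M X := by
  obtain ⟨B, hB⟩ := M.exists_isBase
  exact Nat.sInf_mem (s := {k : ℕ | ∃ B, M.IsBase B ∧ (B ∩ X).ncard = k}) ⟨_, B, hB, rfl⟩

-- All bases have the same size, so being maximal on `X` is being minimal on its complement.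
variable (M) in
theorem rk_add_minElts_compl (X : Set (Fin n)) : rk M X + minElts M Xᶜ = rk M M.E := by
  obtain ⟨B, hB, hBX⟩ := exists_isBase_ncard_inter_eq_rk M X
  obtain ⟨B', hB', hBX'⟩ := exists_isBase_ncard_inter_eq_minElts M Xᶜ
  have h1 := ncard_inter_add_ncard_inter_compl B X
  have h2 := ncard_inter_add_ncard_inter_compl B' X
  have h3 := minElts_le hB Xᶜ
  have h4 := ncard_isBase_inter_le_rk M hB' X
  rw [ncard_eq_rk_ground hB] at h1
  rw [ncard_eq_rk_ground hB'] at h2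
  omega

/-- `|B ∩ ·|` is modular, the rank is submodular and dominates it; equality at `X` and `Y` forces
equality at both combinations. -/
theorem tight_inter_union {B X Y : Set (Fin n)} (hB : M.IsBase B)
    (hX : (B ∩ X).ncard = rk M X) (hY : (B ∩ Y).ncard = rk M Y) :
    (B ∩ (X ∩ Y)).ncard = rk M (X ∩ Y) ∧ (B ∩ (X ∪ Y)).ncard = rk M (X ∪ Y) := by
  have h1 := rk_inter_add_rk_union_le M X Y
  have h2 := ncard_isBase_inter_le_rk M hB (X ∩ Y)
  have h3 := ncard_isBase_inter_le_rk M hB (X ∪ Y)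
  have h4 := Set.ncard_union_add_ncard_inter (B ∩ X) (B ∩ Y)
  rw [← Set.inter_union_distrib_left, ← Set.inter_inter_distrib_left] at h4
  omega

theorem rk_biUnion_le {ι : Type*} (F : Finset ι) (X : ι → Set (Fin n)) :
    rk M (⋃ i ∈ F, X i) ≤ ∑ i ∈ F, rk M (X i) := by
  classical
  induction F using Finset.induction_on with
  | empty =>
    have h := coe_rk M ∅
    simp only [Matroid.eRk_empty] at h
    have h' : rk M ∅ = 0 := by exact_mod_cast h
    simp [h']
  | insert i F hi ih =>
    rw [Finset.set_biUnion_insert, Finset.sum_insert hi]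
    have h := rk_inter_add_rk_union_le M (X i) (⋃ j ∈ F, X j)
    omega

end Rank

/-! ### Cyclically ordered families of intervals -/

section Geometry

variable {n s : ℕ} {a b : Fin s → Fin n}

/-- The base point may be taken to be any starting point `a t`, with the indices then read
cyclically from `t`. -/
theorem CyclicallyOrdered.rebase (h : CyclicallyOrdered a b) (t : Fin s) :
    (∀ u, (a u - a t).val ≤ (b u - a t).val) ∧
      ∀ u v, (u - t).val < (v - t).val → (b u - a t).val < (a v - a t).val := by
  obtain ⟨c, hle, hlt⟩ := h
  have hle' : ∀ i, (a i - c).val ≤ (b i - c).val := hle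
  have hlt' : ∀ i j : Fin s, i.val < j.val → (b i - c).val < (a j - c).val := hlt
  constructor
  · intro u
    rcases eq_or_ne u t with rfl | hut
    · simp [val_sub_self]
    have h1 := hle' u
    have h2 := hle' t
    have h3 := hlt' u t
    have h4 := hlt' t u
    have h5 := (b t - c).isLt
    have h6 := (b u - c).isLt
    have h7 : u.val ≠ t.val := fun e => hut (Fin.ext e)
    rw [val_sub_rebase c (a u) (a t), val_sub_rebase c (b u) (a t)]
    split_ifs <;> omega
  · intro u v huv
    rcases eq_or_ne v t with rfl | hvt
    · rw [val_sub_self] at huv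
      omega
    have h1 := hle' u
    have h2 := hle' t
    have h3 := hle' v
    have h4 := hlt' t v
    have h5 := hlt' v t
    have h6 := (b t - c).isLt
    have h7 := (b u - c).isLt
    have h8 := (b v - c).isLt
    have h9 : v.val ≠ t.val := fun e => hvt (Fin.ext e)
    have hs1 := v.isLt
    have hs2 := u.isLt
    have hs3 := t.isLt
    rw [val_sub_rebase c (b u) (a t), val_sub_rebase c (a v) (a t)]
    rw [val_sub_eq_ite, val_sub_eq_ite] at huv
    rcases eq_or_ne u t with rfl | hut
    · split_ifs at huv ⊢ <;> omega
    have h10 : u.val ≠ t.val := fun e => hut (Fin.ext e)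
    have h11 := hlt' u v
    have h12 := hlt' t u
    have h13 := hlt' u t
    split_ifs at huv ⊢ <;> omega

theorem CyclicallyOrdered.cycIcc_uncross (h : CyclicallyOrdered a b) {t t' r r' : Fin s}
    (h1 : (t' - t).val ≤ (r - t).val) (h2 : (r - t).val < (r' - t).val) :
    cycIcc (a t) (b r) ∩ cycIcc (a t') (b r') = cycIcc (a t') (b r) ∧
      cycIcc (a t) (b r) ∪ cycIcc (a t') (b r') = cycIcc (a t) (b r') := by
  obtain ⟨hle, hlt⟩ := h.rebase t
  have k1 : (a t' - a t).val ≤ (b r - a t).val := by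
    rcases h1.eq_or_lt with e | e
    · rw [val_sub_inj e]
      exact hle r
    · exact (hle t').trans ((hlt _ _ e).le.trans (hle r))
  have k2 : (b r - a t).val < (b r' - a t).val := (hlt _ _ h2).trans_le (hle r')
  have k3 := val_sub_self (a t)
  constructor
  · ext x
    simp only [Set.mem_inter_iff, mem_cycIcc_iff_rebase (a t), k3]
    split_ifs <;> omega
  · ext x
    simp only [Set.mem_union, mem_cycIcc_iff_rebase (a t), k3]
    split_ifs <;> omega

end Geometry

/-! ### Prefix counts -/

section Prefix

variable {n : ℕ}

/-- The number of elements of `B` among the first `k` elements in the cyclic order starting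
at `c`. -/
noncomputable def prefixCount (c : Fin n) (B : Set (Fin n)) (k : ℕ) : ℤ :=
  ((B ∩ {x | (x - c).val < k}).ncard : ℤ)

variable (c : Fin n) (B : Set (Fin n))

theorem prefixCount_add_ncard {p q : ℕ} (hpq : p ≤ q) :
    prefixCount c B p + (B ∩ {x | p ≤ (x - c).val ∧ (x - c).val < q}).ncard =
      prefixCount c B q := by
  have hd : Disjoint (B ∩ {x | (x - c).val < p})
      (B ∩ {x | p ≤ (x - c).val ∧ (x - c).val < q}) := by
    rw [Set.disjoint_left]
    rintro x ⟨_, hx⟩ ⟨_, hx'⟩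
    simp only [Set.mem_ofPred_eq] at hx hx'
    omega
  have h := Set.ncard_union_eq hd
  rw [← Set.inter_union_distrib_left] at h
  have he : ({x | (x - c).val < p} ∪ {x | p ≤ (x - c).val ∧ (x - c).val < q}) =
      {x : Fin n | (x - c).val < q} := by
    ext x
    simp only [Set.mem_union, Set.mem_ofPred_eq]
    omega
  rw [he] at h
  simp only [prefixCount]
  exact_mod_cast h.symm

theorem prefixCount_zero : prefixCount c B 0 = 0 := by
  simp [prefixCount]

theorem prefixCount_self : prefixCount c B n = B.ncard := by
  have h : {x : Fin n | (x - c).val < n} = Set.univ := by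
    ext x
    simp only [Set.mem_ofPred_eq, Set.mem_univ, iff_true]
    exact (x - c).isLt
  rw [prefixCount, h, Set.inter_univ]

/-- The wrap-around correction depends only on `|B|`, so for sets of equal size comparing interval
counts amounts to comparing differences of prefix counts, even when the end precedes the start. -/
theorem ncard_inter_cycIcc (x y : Fin n) :
    ((B ∩ cycIcc x y).ncard : ℤ) =
      prefixCount c B ((y - c).val + 1) - prefixCount c B (x - c).val +
        if (x - c).val ≤ (y - c).val then 0 else (B.ncard : ℤ) := by
  split_ifs with h
  · rw [← prefixCount_add_ncard c B (h.trans (Nat.le_succ _))]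
    have he : cycIcc x y = {z | (x - c).val ≤ (z - c).val ∧ (z - c).val < (y - c).val + 1} := by
      ext z
      rw [mem_cycIcc_iff_rebase c, if_pos h, Set.mem_ofPred_eq]
      omega
    rw [he]
    ring
  · rw [← ncard_inter_add_ncard_inter_compl B (cycIcc x y),
      ← prefixCount_add_ncard c B (Nat.succ_le_of_lt (not_le.mp h))]
    have he : (cycIcc x y)ᶜ =
        {z | (y - c).val + 1 ≤ (z - c).val ∧ (z - c).val < (x - c).val} := by
      ext z
      rw [Set.mem_compl_iff, mem_cycIcc_iff_rebase c, if_neg h, Set.mem_ofPred_eq]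
      omega
    rw [he]
    push_cast
    simp only [Nat.succ_eq_add_one]
    ring

open Classical in
theorem prefixCount_succ (x : Fin n) :
    prefixCount c B ((x - c).val + 1) =
      prefixCount c B (x - c).val + if x ∈ B then 1 else 0 := by
  rw [← prefixCount_add_ncard c B (Nat.le_succ (x - c).val)]
  congr 1
  have he : {z : Fin n | (x - c).val ≤ (z - c).val ∧ (z - c).val < Nat.succ (x - c).val} =
      {x} := by
    ext z
    simp only [Set.mem_ofPred_eq, Set.mem_singleton_iff]
    constructor
    · intro h
      exact val_sub_inj (z := c) (by omega)
    · rintro rfl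
      omega
  rw [he]
  split_ifs with hx
  · rw [Set.inter_eq_right.mpr (Set.singleton_subset_iff.mpr hx)]
    simp
  · rw [Set.inter_singleton_eq_empty.mpr hx]
    simp

theorem exists_val_sub_eq {k : ℕ} (hk : k < n) : ∃ x : Fin n, (x - c).val = k := by
  have : NeZero n := c.neZero
  exact ⟨⟨k, hk⟩ + c, by simp⟩

theorem prefixCount_step {k : ℕ} (hk : k < n) :
    prefixCount c B k ≤ prefixCount c B (k + 1) ∧
      prefixCount c B (k + 1) ≤ prefixCount c B k + 1 := by
  classical
  obtain ⟨x, rfl⟩ := exists_val_sub_eq c hk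
  rw [prefixCount_succ]
  split_ifs <;> omega

variable {B} {d : ℕ} {I : Fin n → Finset (Fin n)} {M : Matroid (Fin n)}

/-- An integer function on positions whose differences are dominated by those of bases is the
prefix count of a basis. -/
theorem IsPositroidOf.exists_isBase_of_potential [NeZero n] (hM : IsPositroidOf d I M)
    (c : Fin n) (y : ℕ → ℤ)
    (hy : ∀ p q, p ≤ n → q ≤ n →
      ∃ B, M.IsBase B ∧ y q - y p ≤ prefixCount c B q - prefixCount c B p) :
    ∃ B, M.IsBase B ∧ ∀ k ≤ n, prefixCount c B k = y k - y 0 := by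
  classical
  have hcard : ∀ {B}, M.IsBase B → B.ncard = d := fun hB => ((hM.isBase_iff_ncard _).1 hB).1
  -- The bounds for `(k, k + 1)` and `(k + 1, k)` force every increment of `y` to be 0 or 1; `B'`
  -- collects the places where it is 1.
  set B' : Set (Fin n) := {x | y ((x - c).val + 1) = y (x - c).val + 1} with hB'
  have hpre : ∀ k ≤ n, prefixCount c B' k = y k - y 0 := by
    intro k
    induction k with
    | zero => simp [prefixCount_zero]
    | succ k ih =>
      intro hk
      obtain ⟨B₁, -, h₁⟩ := hy k (k + 1) (by omega) hk
      obtain ⟨B₂, -, h₂⟩ := hy (k + 1) k hk (by omega)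
      have h₁' := prefixCount_step c B₁ (Nat.lt_of_succ_le hk)
      have h₂' := prefixCount_step c B₂ (Nat.lt_of_succ_le hk)
      have ih' := ih (by omega)
      obtain ⟨x, rfl⟩ := exists_val_sub_eq c (Nat.lt_of_succ_le hk)
      rw [prefixCount_succ, ih']
      have hx : x ∈ B' ↔ y ((x - c).val + 1) = y (x - c).val + 1 := Iff.rfl
      split_ifs with h
      · rw [hx] at h
        omega
      · rw [hx] at h
        omega
  refine ⟨B', (hM.isBase_iff_ncard B').2 ?_, hpre⟩
  have hd : B'.ncard = d := by
    obtain ⟨B₁, hB₁, h₁⟩ := hy 0 n (by omega) le_rfl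
    obtain ⟨B₂, hB₂, h₂⟩ := hy n 0 le_rfl (by omega)
    rw [prefixCount_self, prefixCount_zero, hcard hB₁] at h₁
    rw [prefixCount_self, prefixCount_zero, hcard hB₂] at h₂
    have h := hpre n le_rfl
    rw [prefixCount_self] at h
    omega
  refine ⟨hd, fun j x => ?_⟩
  have hj := (j - c).isLt
  have hx := (x - c).isLt
  obtain ⟨B₁, hB₁, h₁⟩ := hy (j - c).val ((x - c).val + 1) (by omega) (by omega)
  refine le_trans ?_ (((hM.isBase_iff_ncard B₁).1 hB₁).2 j x)
  zify
  rw [ncard_inter_cycIcc c, ncard_inter_cycIcc c, hd, hcard hB₁, hpre _ (by omega),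
    hpre _ (by omega)]
  omega

end Prefix

/-! ### Gaps, rank bounds and tight intervals -/

section Intervals

variable {n m s : ℕ}

theorem CyclicallyOrdered.disjoint {a b : Fin m → Fin n} (h : CyclicallyOrdered a b) :
    Pairwise (Function.onFun Disjoint fun i => cycIcc (a i) (b i)) := by
  obtain ⟨c, hle, hlt⟩ := h
  have hle' : ∀ i, (a i - c).val ≤ (b i - c).val := hle
  have hlt' : ∀ i j : Fin m, i < j → (b i - c).val < (a j - c).val := hlt
  intro i j hij
  rw [Function.onFun, Set.disjoint_left]
  intro x hi hj
  rw [mem_cycIcc_iff_rebase c, if_pos (hle' _)] at hi hj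
  rcases lt_or_gt_of_ne hij with hij | hij
  · have := hlt' _ _ hij
    omega
  · have := hlt' _ _ hij
    omega

theorem CyclicallyOrdered.ncard_inter_biUnion {a b : Fin m → Fin n} (h : CyclicallyOrdered a b)
    (B : Set (Fin n)) (T : Finset (Fin m)) :
    (B ∩ ⋃ i ∈ T, cycIcc (a i) (b i)).ncard = ∑ i ∈ T, (B ∩ cycIcc (a i) (b i)).ncard := by
  classical
  induction T using Finset.induction_on with
  | empty => simp
  | insert i T hi ih =>
    rw [Finset.set_biUnion_insert, Finset.sum_insert hi, ← ih, Set.inter_union_distrib_left,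
      Set.ncard_union_eq]
    refine Set.disjoint_of_subset Set.inter_subset_right Set.inter_subset_right ?_
    rw [Set.disjoint_iUnion₂_right]
    intro j hj
    exact h.disjoint (fun e => hi (e ▸ hj))

theorem CyclicallyOrdered.ncard_inter_iUnion {a b : Fin m → Fin n} (h : CyclicallyOrdered a b)
    (B : Set (Fin n)) :
    (B ∩ ⋃ i, cycIcc (a i) (b i)).ncard = ∑ i, (B ∩ cycIcc (a i) (b i)).ncard := by
  rw [← h.ncard_inter_biUnion B univ]
  simp

/-- The intervals of a cyclically ordered family and the gaps between them partition the
circle. -/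
theorem CyclicallyOrdered.sum_ncard_gap [NeZero m] {a b : Fin m → Fin n}
    (h : CyclicallyOrdered a b) (B : Set (Fin n)) :
    ∑ i, (B ∩ cycIoo (b i) (a (finRotate m i))).ncard +
      (B ∩ ⋃ i, cycIcc (a i) (b i)).ncard = B.ncard := by
  rw [h.ncard_inter_iUnion]
  obtain ⟨c, hle, hlt⟩ := h
  have hle' : ∀ i, (a i - c).val ≤ (b i - c).val := hle
  have hlt' : ∀ i j : Fin m, i.val < j.val → (b i - c).val < (a j - c).val := hlt
  obtain ⟨k, rfl⟩ : ∃ k, m = k + 1 := Nat.exists_eq_succ_of_ne_zero (NeZero.ne m)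
  -- Closing the cycle from the last interval to the first adds one full turn, hence a single
  -- correction `B.ncard`.
  have hgap : ∀ i, ((B ∩ cycIoo (b i) (a (finRotate (k + 1) i))).ncard : ℤ) =
      prefixCount c B (a (finRotate (k + 1) i) - c).val -
        prefixCount c B ((b i - c).val + 1) + if i = Fin.last k then (B.ncard : ℤ) else 0 := by
    intro i
    have h1 := ncard_inter_add_ncard_inter_compl B (cycIcc (a (finRotate (k + 1) i)) (b i))
    have h2 := ncard_inter_cycIcc c B (a (finRotate (k + 1) i)) (b i)
    have h3 : (a (finRotate (k + 1) i) - c).val ≤ (b i - c).val ↔ i = Fin.last k := by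
      have h4 : (finRotate (k + 1) i).val = if i = Fin.last k then 0 else i.val + 1 :=
        coe_finRotate i
      split_ifs at h4 with hi
      · refine iff_of_true ?_ hi
        rcases (Nat.zero_le i.val).eq_or_lt with e | e
        · rw [show finRotate (k + 1) i = i from Fin.ext (h4.trans e)]
          exact hle' i
        · have h5 := hlt' (finRotate (k + 1) i) i (by omega)
          have h6 := hle' (finRotate (k + 1) i)
          exact h6.trans h5.le |>.trans (hle' i)
      · refine iff_of_false ?_ hi
        rw [not_le]
        exact hlt' _ _ (by omega)
    rw [cycIoo]
    simp only [h3] at h2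
    split_ifs at h2 ⊢ <;> omega
  zify
  simp only [hgap, ncard_inter_cycIcc c B, hle', if_true]
  rw [Finset.sum_add_distrib, Finset.sum_sub_distrib,
    Equiv.sum_comp (finRotate (k + 1)) (fun i => prefixCount c B (a i - c).val),
    Finset.sum_add_distrib, Finset.sum_sub_distrib]
  simp only [Finset.sum_ite_eq', mem_univ, if_true, Finset.sum_const_zero]
  ring

theorem CyclicallyOrdered.restrictBlock {a b : Fin s → Fin n} (h : CyclicallyOrdered a b)
    (T : Finset (Fin s)) :
    CyclicallyOrdered (restrictBlock a T) (restrictBlock b T) := by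
  obtain ⟨c, hle, hlt⟩ := h
  exact ⟨c, fun i => hle _, fun i j hij => hlt _ _ ((T.orderEmbOfFin rfl).strictMono hij)⟩

theorem iUnion_restrictBlock (a b : Fin s → Fin n) (T : Finset (Fin s)) :
    ⋃ i, cycIcc (restrictBlock a T i) (restrictBlock b T i) =
      ⋃ t ∈ T, cycIcc (a t) (b t) := by
  ext x
  simp only [Set.mem_iUnion, restrictBlock, exists_prop]
  constructor
  · rintro ⟨i, hi⟩
    exact ⟨_, T.orderEmbOfFin_mem rfl i, hi⟩
  · rintro ⟨t, ht, hx⟩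
    have : t ∈ Set.range (T.orderEmbOfFin rfl) := by
      rw [Finset.range_orderEmbOfFin]
      exact ht
    obtain ⟨i, rfl⟩ := this
    exact ⟨i, hx⟩

variable {M : Matroid (Fin n)}

theorem CyclicallyOrdered.rk_le_nbd [NeZero m] {a b : Fin m → Fin n}
    (h : CyclicallyOrdered a b) : (rk M (⋃ i, cycIcc (a i) (b i)) : ℤ) ≤ nbd M a b := by
  obtain ⟨B, hB, hBX⟩ := exists_isBase_ncard_inter_eq_rk M (⋃ i, cycIcc (a i) (b i))
  have h1 := h.sum_ncard_gap B
  have h2 : ∑ i, minElts M (cycIoo (b i) (a (finRotate m i))) ≤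
      ∑ i, (B ∩ cycIoo (b i) (a (finRotate m i))).ncard :=
    Finset.sum_le_sum fun i _ => minElts_le hB _
  rw [ncard_eq_rk_ground hB, hBX] at h1
  rw [nbd, ← Nat.cast_sum]
  omega

/-- The gap `(b_i, a_{i+1})` is the complement of the tight interval `[a_{i+1}, b_i]`, so `B`
attains `minElts` in every gap and what remains of `B` lies in the intervals. -/
theorem CyclicallyOrdered.nbd_eq_of_tight [NeZero m] {a b : Fin m → Fin n}
    (h : CyclicallyOrdered a b) {B : Set (Fin n)} (hB : M.IsBase B)
    (ht : ∀ i, (B ∩ cycIcc (a (finRotate m i)) (b i)).ncard =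
      rk M (cycIcc (a (finRotate m i)) (b i))) :
    nbd M a b = (B ∩ ⋃ i, cycIcc (a i) (b i)).ncard := by
  have h1 := h.sum_ncard_gap B
  have h2 : ∀ i, minElts M (cycIoo (b i) (a (finRotate m i))) =
      (B ∩ cycIoo (b i) (a (finRotate m i))).ncard := by
    intro i
    have h3 := rk_add_minElts_compl M (cycIcc (a (finRotate m i)) (b i))
    have h4 := ncard_inter_add_ncard_inter_compl B (cycIcc (a (finRotate m i)) (b i))
    have h5 := ht i
    have h6 := ncard_eq_rk_ground hB
    rw [cycIoo]
    omega
  rw [ncard_eq_rk_ground hB] at h1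
  rw [nbd, ← Nat.cast_sum]
  simp only [h2]
  omega

theorem CyclicallyOrdered.rk_le_nbdPartition {a b : Fin s → Fin n} (h : CyclicallyOrdered a b)
    (P : Finpartition (univ : Finset (Fin s))) :
    (rk M (⋃ i, cycIcc (a i) (b i)) : ℤ) ≤ nbdPartition M a b P := by
  have h1 : (⋃ i, cycIcc (a i) (b i)) = ⋃ T ∈ P.parts, ⋃ t ∈ T, cycIcc (a t) (b t) := by
    ext x
    simp only [Set.mem_iUnion, exists_prop]
    constructor
    · rintro ⟨i, hi⟩
      obtain ⟨T, hT, hiT⟩ := P.exists_mem (mem_univ i)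
      exact ⟨T, hT, i, hiT, hi⟩
    · rintro ⟨T, -, i, -, hi⟩
      exact ⟨i, hi⟩
  rw [h1]
  have h2 := rk_biUnion_le (M := M) P.parts fun T => ⋃ t ∈ T, cycIcc (a t) (b t)
  have h3 : (rk M (⋃ T ∈ P.parts, ⋃ t ∈ T, cycIcc (a t) (b t)) : ℤ) ≤
      ∑ T ∈ P.parts, (rk M (⋃ t ∈ T, cycIcc (a t) (b t)) : ℤ) := by
    exact_mod_cast h2
  refine h3.trans (Finset.sum_le_sum fun T hT => ?_)
  have : NeZero T.card := ⟨Finset.card_ne_zero.mpr (P.nonempty_of_mem_parts hT)⟩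
  rw [← iUnion_restrictBlock]
  exact (h.restrictBlock T).rk_le_nbd

/-- If a basis `B` meets a union of intervals in as many elements as possible, then the starting
points can be matched with the end points by intervals in which `B` has full rank. -/
theorem IsPositroidOf.exists_tight_perm [NeZero n] {d : ℕ} {I : Fin n → Finset (Fin n)}
    (hM : IsPositroidOf d I M) {a b : Fin s → Fin n} (h : CyclicallyOrdered a b)
    {B : Set (Fin n)} (hB : M.IsBase B)
    (hmax : ∀ B', M.IsBase B' →
      (B' ∩ ⋃ i, cycIcc (a i) (b i)).ncard ≤ (B ∩ ⋃ i, cycIcc (a i) (b i)).ncard) :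
    ∃ σ : Equiv.Perm (Fin s), ∀ t,
      (B ∩ cycIcc (a t) (b (σ t))).ncard = rk M (cycIcc (a t) (b (σ t))) := by
  classical
  let N : Fin s → Finset (Fin s) := fun t =>
    univ.filter fun r => (B ∩ cycIcc (a t) (b r)).ncard = rk M (cycIcc (a t) (b r))
  -- Hall's marriage theorem for the relation "`[a t, b r]` is tight".
  suffices hN : ∀ S : Finset (Fin s), S.card ≤ (S.biUnion N).card by
    obtain ⟨f, hf, hfN⟩ := (Finset.all_card_le_biUnion_card_iff_exists_injective N).1 hN
    exact ⟨Equiv.ofBijective f (Finite.injective_iff_bijective.1 hf), fun t =>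
      (Finset.mem_filter.1 (hfN t)).2⟩
  intro S
  by_contra! hS
  obtain ⟨t₀, -⟩ : S.Nonempty := Finset.card_pos.1 (by omega)
  have hU : (univ : Finset (Fin s)).Nonempty := ⟨t₀, mem_univ _⟩
  have hsum : ∀ B', (B' ∩ ⋃ i, cycIcc (a i) (b i)).ncard =
      ∑ i, (B' ∩ cycIcc (a i) (b i)).ncard := h.ncard_inter_iUnion
  obtain ⟨c, hle, -⟩ := h
  have hle' : ∀ i, (a i - c).val ≤ (b i - c).val := hle
  have hexists : ∀ p q : ℕ, ∃ B₁, M.IsBase B₁ ∧ ∀ B₂, M.IsBase B₂ →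
      prefixCount c B₂ q - prefixCount c B₂ p ≤ prefixCount c B₁ q - prefixCount c B₁ p :=
    fun p q => by
      obtain ⟨B₁, h₁, h₂⟩ := Set.exists_max_image {B₁ | M.IsBase B₁}
        (fun B₁ => prefixCount c B₁ q - prefixCount c B₁ p) (Set.toFinite _) ⟨B, hB⟩
      exact ⟨B₁, h₁, h₂⟩
  choose Bm hBm hBmax using hexists
  -- The largest increment of a prefix count from `p` to `q` over all bases. It satisfies the
  -- triangle inequality and serves as a directed distance.
  let D : ℕ → ℕ → ℤ := fun p q => prefixCount c (Bm p q) q - prefixCount c (Bm p q) p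
  have hD : ∀ p q B₂, M.IsBase B₂ → prefixCount c B₂ q - prefixCount c B₂ p ≤ D p q :=
    fun p q B₂ hB₂ => hBmax p q B₂ hB₂
  have htri : ∀ p q r, D p r ≤ D p q + D q r := by
    intro p q r
    have h1 := hD p q _ (hBm p r)
    have h2 := hD q r _ (hBm p r)
    simp only [D] at h1 h2 ⊢
    omega
  -- Prescribed values at the starting points: those of `B`, lowered by 1 on the Hall violator `S`.
  -- Next, `y` is the largest extension compatible with the distance `D`.
  let u : Fin s → ℤ := fun t => prefixCount c B (a t - c).val - if t ∈ S then 1 else 0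
  let y : ℕ → ℤ := fun k => univ.inf' hU fun t => u t + D (a t - c).val k
  have hy : ∀ p q, y q - y p ≤ D p q := by
    intro p q
    obtain ⟨t, -, ht⟩ := Finset.exists_mem_eq_inf' hU fun t => u t + D (a t - c).val p
    have h1 : y q ≤ u t + D (a t - c).val q := Finset.inf'_le _ (mem_univ t)
    have h2 : y p = u t + D (a t - c).val p := ht
    have h3 := htri (a t - c).val p q
    omega
  obtain ⟨B', hB', hpre⟩ := hM.exists_isBase_of_potential c y fun p q _ _ =>
    ⟨Bm p q, hBm p q, hy p q⟩
  have hya : ∀ t, y (a t - c).val ≤ u t := by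
    intro t
    have h1 : y (a t - c).val ≤ u t + D (a t - c).val (a t - c).val :=
      Finset.inf'_le _ (mem_univ t)
    simpa [D] using h1
  -- A loss at `b r` can only come from some `t ∈ S`; if `[a t, b r]` is not tight, `D` exceeds the
  -- increment of `B` by at least 1 and absorbs it.
  have hyb : ∀ r, prefixCount c B ((b r - c).val + 1) - (if r ∈ S.biUnion N then 1 else 0) ≤
      y ((b r - c).val + 1) := by
    intro r
    refine Finset.le_inf' hU _ fun t _ => ?_
    have h1 := hD (a t - c).val ((b r - c).val + 1) B hB
    simp only [u]
    by_cases htS : t ∈ S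
    · by_cases hr : r ∈ S.biUnion N
      · rw [if_pos htS, if_pos hr]
        omega
      · rw [if_pos htS, if_neg hr]
        have h2 : (B ∩ cycIcc (a t) (b r)).ncard ≠ rk M (cycIcc (a t) (b r)) := fun h3 =>
          hr (Finset.mem_biUnion.2 ⟨t, htS, Finset.mem_filter.2 ⟨mem_univ _, h3⟩⟩)
        have h3 := ncard_isBase_inter_le_rk M hB (cycIcc (a t) (b r))
        obtain ⟨B₁, hB₁, h4⟩ := exists_isBase_ncard_inter_eq_rk M (cycIcc (a t) (b r))
        have h5 := hD (a t - c).val ((b r - c).val + 1) B₁ hB₁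
        have h6 := ncard_inter_cycIcc c B (a t) (b r)
        have h7 := ncard_inter_cycIcc c B₁ (a t) (b r)
        rw [ncard_eq_rk_ground hB₁, ← ncard_eq_rk_ground hB] at h7
        omega
    · rw [if_neg htS]
      split_ifs <;> omega
  have hcount : ((B ∩ ⋃ i, cycIcc (a i) (b i)).ncard : ℤ) + S.card - (S.biUnion N).card ≤
      (B' ∩ ⋃ i, cycIcc (a i) (b i)).ncard := by
    rw [hsum, hsum]
    have h1 : ∀ T : Finset (Fin s), (T.card : ℤ) = ∑ t, if t ∈ T then 1 else 0 := by
      intro T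
      simp
    rw [h1, h1]
    push_cast
    rw [← Finset.sum_add_distrib, ← Finset.sum_sub_distrib]
    refine Finset.sum_le_sum fun t _ => ?_
    have h2 := hya t
    have h3 := hyb t
    have h4 := (a t - c).isLt
    have h5 := (b t - c).isLt
    rw [ncard_inter_cycIcc c, ncard_inter_cycIcc c, if_pos (hle' t), if_pos (hle' t),
      hpre _ (by omega), hpre _ (by omega)]
    simp only [u] at h2
    omega
  have := hmax B' hB'
  omega

end Intervals

/-! ### Non-crossing permutations and partitions -/

section NonCrossing

variable {s : ℕ}

/-- A relation with a perfect matching that is closed under uncrossing has a non-crossing perfect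
matching. -/
theorem exists_noncrossing_perm (R : Fin s → Fin s → Prop)
    (hR : ∀ t t' r r', R t r → R t' r' → (t' - t).val ≤ (r - t).val →
      (r - t).val < (r' - t).val → R t r' ∧ R t' r)
    (h : ∃ σ : Equiv.Perm (Fin s), ∀ t, R t (σ t)) :
    ∃ σ : Equiv.Perm (Fin s), (∀ t, R t (σ t)) ∧
      ∀ t t', t ≠ t' → (t' - t).val ≤ (σ t - t).val → (σ t' - t).val ≤ (σ t - t).val := by
  classical
  obtain ⟨σ, hσ, hmax⟩ := Set.exists_max_image {σ : Equiv.Perm (Fin s) | ∀ t, R t (σ t)}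
    (fun σ => ∑ t, (σ t - t).val ^ 2) (Set.toFinite _) h
  refine ⟨σ, hσ, fun t t' htt' h1 => ?_⟩
  by_contra! h2
  obtain ⟨h3, h4⟩ := hR t t' (σ t) (σ t') (hσ t) (hσ t') h1 h2
  -- Uncrossing nests the two arcs. The total length is unchanged, but the sum of squares grows,
  -- contradicting maximality.
  set τ := σ * Equiv.swap t t' with hτ
  have hτt : τ t = σ t' := by simp [hτ]
  have hτt' : τ t' = σ t := by simp [hτ]
  have hτx : ∀ x, x ≠ t → x ≠ t' → τ x = σ x := fun x hx hx' => by
    simp [hτ, Equiv.swap_apply_of_ne_of_ne hx hx']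
  have hτR : ∀ x, R x (τ x) := by
    intro x
    rcases eq_or_ne x t with rfl | hx
    · rwa [hτt]
    rcases eq_or_ne x t' with rfl | hx'
    · rwa [hτt']
    rw [hτx x hx hx']
    exact hσ x
  have h5 := hmax τ hτR
  have hsplit : ∀ f : Fin s → ℕ, ∑ x, f x = f t + (f t' + ∑ x ∈ (univ.erase t).erase t', f x) := by
    intro f
    rw [Finset.add_sum_erase _ _ (by simp [htt'.symm]), Finset.add_sum_erase _ _ (mem_univ t)]
  rw [hsplit, hsplit (fun x => (σ x - x).val ^ 2)] at h5
  have h6 : ∑ x ∈ (univ.erase t).erase t', (τ x - x).val ^ 2 =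
      ∑ x ∈ (univ.erase t).erase t', (σ x - x).val ^ 2 := by
    refine Finset.sum_congr rfl fun x hx => ?_
    simp only [Finset.mem_erase] at hx
    rw [hτx x hx.2.1 hx.1]
  rw [h6, hτt, hτt'] at h5
  have h7 : (σ t - t').val = (σ t - t).val - (t' - t).val := by
    rw [val_sub_rebase t, if_pos h1]
  have h8 : (σ t' - t').val = (σ t' - t).val - (t' - t).val := by
    rw [val_sub_rebase t, if_pos (h1.trans h2.le)]
  have h9 : 0 < (t' - t).val := by
    rcases Nat.eq_zero_or_pos (t' - t).val with e | e
    · exact absurd (val_sub_inj (e.trans (val_sub_self t).symm)).symm htt'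
    · exact e
  obtain ⟨x, hx⟩ := Nat.exists_eq_add_of_le h1
  obtain ⟨z, hz⟩ := Nat.exists_eq_add_of_lt h2
  rw [h7, h8, hz, hx] at h5
  rw [Nat.add_sub_cancel_left, show (t' - t).val + x + z + 1 - (t' - t).val = x + z + 1 by omega]
    at h5
  nlinarith

variable {σ : Equiv.Perm (Fin s)}

/-- The arcs of a non-crossing permutation are invariant. -/
theorem apply_mem_cycIcc
    (hσ : ∀ t t', t ≠ t' → (t' - t).val ≤ (σ t - t).val → (σ t' - t).val ≤ (σ t - t).val)
    (t x : Fin s) (hx : x ∈ cycIcc t (σ t)) : σ x ∈ cycIcc t (σ t) := by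
  rcases eq_or_ne t x with rfl | h
  · exact le_refl (σ t - t)
  · exact hσ t x h hx

theorem SameCycle.mem_cycIcc_iff
    (hσ : ∀ t t', t ≠ t' → (t' - t).val ≤ (σ t - t).val → (σ t' - t).val ≤ (σ t - t).val)
    (t : Fin s) {x y : Fin s} (hxy : σ.SameCycle x y) :
    x ∈ cycIcc t (σ t) ↔ y ∈ cycIcc t (σ t) := by
  have key : ∀ {x y : Fin s}, σ.SameCycle x y → x ∈ cycIcc t (σ t) → y ∈ cycIcc t (σ t) := by
    intro x y hxy hx
    obtain ⟨k, rfl⟩ := hxy.exists_nat_pow_eq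
    clear hxy
    induction k with
    | zero => exact hx
    | succ k ih =>
      rw [pow_succ', Equiv.Perm.mul_apply]
      exact apply_mem_cycIcc hσ t _ ih
  exact ⟨key hxy, key hxy.symm⟩

open Classical in
/-- The partition into the orbits of a permutation. -/
noncomputable def orbitPartition (σ : Equiv.Perm (Fin s)) :
    Finpartition (univ : Finset (Fin s)) :=
  Finpartition.ofSetoid (Equiv.Perm.SameCycle.setoid σ)

theorem sameCycle_of_mem_parts {T : Finset (Fin s)} (hT : T ∈ (orbitPartition σ).parts)
    {t u : Fin s} (ht : t ∈ T) : u ∈ T ↔ σ.SameCycle t u := by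
  classical
  have h := Finpartition.mem_part_ofSetoid_iff_rel (s := Equiv.Perm.SameCycle.setoid σ)
    (a := t) (b := u)
  rw [← (orbitPartition σ).part_eq_of_mem hT ht]
  exact h

theorem isNonCrossing_orbitPartition
    (hσ : ∀ t t', t ≠ t' → (t' - t).val ≤ (σ t - t).val → (σ t' - t).val ≤ (σ t - t).val) :
    IsNonCrossing (orbitPartition σ) := by
  rintro T hT U hU hTU ⟨i, w, x, y, z, hwx, hxy, hyz, hw, hy, hx, hz⟩
  have hxT : x ∉ T := fun h => hTU ((orbitPartition σ).eq_of_mem_parts hT hU h hx)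
  -- `y'` is the first element of `T` after `x`. The invariant arc `[y', σ y']` contains `T` but not
  -- `x`, hence misses `U`; yet seen from `x`, `z` lies between `y` and `w`, both in the arc.
  obtain ⟨y', hy', hmin⟩ := Finset.exists_min_image T (fun v => (v - x).val) ⟨y, hy⟩
  have hT' : ∀ v ∈ T, v ∈ cycIcc y' (σ y') := fun v hv =>
    (SameCycle.mem_cycIcc_iff hσ y' ((sameCycle_of_mem_parts hT hy').1 hv)).1
      (show (y' - y').val ≤ _ by rw [val_sub_self]; exact Nat.zero_le _)
  have hσy' : σ y' ∈ T :=
    (sameCycle_of_mem_parts hT hy').2 (Equiv.Perm.sameCycle_apply_right.2 (.refl _ _))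
  have hpos : 0 < (y' - x).val := by
    rcases Nat.eq_zero_or_pos (y' - x).val with e | e
    · exact absurd (val_sub_inj (e.trans (val_sub_self x).symm) ▸ hy') hxT
    · exact e
  have h1 := hmin (σ y') hσy'
  have h2 := hmin y hy
  have h3 := hT' w hw
  have h4 : x ∉ cycIcc y' (σ y') := by
    rw [mem_cycIcc_iff_rebase x, if_pos h1, val_sub_self]
    omega
  have h5 : z ∉ cycIcc y' (σ y') := fun h =>
    h4 ((SameCycle.mem_cycIcc_iff hσ y' ((sameCycle_of_mem_parts hU hx).1 hz)).2 h)
  rw [mem_cycIcc_iff_rebase x, if_pos h1] at h3 h5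
  have k1 : (w - i).val < (x - i).val := hwx
  have k2 : (x - i).val < (y - i).val := hxy
  have k3 : (y - i).val < (z - i).val := hyz
  have k4 := (z - i).isLt
  have k5 := val_sub_rebase i y x
  have k6 := val_sub_rebase i z x
  have k7 := val_sub_rebase i w x
  rw [if_pos (by omega)] at k5
  rw [if_pos (by omega)] at k6
  rw [if_neg (by omega)] at k7
  omega

theorem val_finRotate {m : ℕ} (k : Fin m) :
    (finRotate m k).val = if k.val + 1 = m then 0 else k.val + 1 := by
  obtain ⟨m, rfl⟩ := Nat.exists_eq_succ_of_ne_zero k.neZero.out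
  rw [coe_finRotate]
  simp only [Fin.ext_iff, Fin.val_last, Nat.succ_eq_add_one, Nat.add_right_cancel_iff]

/-- The arc `[t, σ t]` is invariant, so it contains the whole block of `t`. Thus `σ t` is the last
element of the block seen from `t`, its cyclic predecessor. -/
theorem apply_orderEmbOfFin_finRotate
    (hσ : ∀ t t', t ≠ t' → (t' - t).val ≤ (σ t - t).val → (σ t' - t).val ≤ (σ t - t).val)
    {T : Finset (Fin s)} (hT : T ∈ (orbitPartition σ).parts) (k : Fin T.card) :
    σ (T.orderEmbOfFin rfl (finRotate T.card k)) = T.orderEmbOfFin rfl k := by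
  set t := T.orderEmbOfFin rfl (finRotate T.card k) with ht
  set u := T.orderEmbOfFin rfl k with hu
  have htT : t ∈ T := T.orderEmbOfFin_mem rfl _
  have huT : u ∈ T := T.orderEmbOfFin_mem rfl _
  have h1 : (u - t).val ≤ (σ t - t).val :=
    (SameCycle.mem_cycIcc_iff hσ t ((sameCycle_of_mem_parts hT htT).1 huT)).1
      (show (t - t).val ≤ _ by rw [val_sub_self]; exact Nat.zero_le _)
  have hσt : σ t ∈ T :=
    (sameCycle_of_mem_parts hT htT).2 (Equiv.Perm.sameCycle_apply_right.2 (.refl _ _))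
  refine val_sub_inj (z := t) (le_antisymm ?_ h1)
  obtain ⟨l, hl⟩ : ∃ l, T.orderEmbOfFin rfl l = σ t := by
    have : σ t ∈ Set.range (T.orderEmbOfFin rfl) := by
      rw [Finset.range_orderEmbOfFin]
      exact hσt
    exact this
  have hmono : ∀ p q : Fin T.card, p.val ≤ q.val →
      (T.orderEmbOfFin rfl p).val ≤ (T.orderEmbOfFin rfl q).val := fun p q hpq =>
    (T.orderEmbOfFin rfl).monotone hpq
  have hsucc := val_finRotate k
  have hlk := l.isLt
  have hs1 := (σ t).isLt
  rw [← hl] at hs1 ⊢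
  have e1 := hmono l k
  have e2 := hmono (finRotate T.card k) l
  have e3 : k.val < (finRotate T.card k).val → u.val < t.val := fun h =>
    (T.orderEmbOfFin rfl).strictMono h
  rw [← ht] at e2
  rw [← hu] at e1
  rw [val_sub_eq_ite, val_sub_eq_ite]
  split_ifs at hsucc ⊢ <;> omega

end NonCrossing

/-- The rank of a union of intervals is attained by the bound of a non-crossing partition. -/
theorem IsPositroidOf.exists_isNonCrossing_rk_eq {n s : ℕ} [NeZero n] {d : ℕ}
    {I : Fin n → Finset (Fin n)} {M : Matroid (Fin n)} (hM : IsPositroidOf d I M)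
    {a b : Fin s → Fin n} (h : CyclicallyOrdered a b) :
    ∃ P : Finpartition (univ : Finset (Fin s)), IsNonCrossing P ∧
      (rk M (⋃ i, cycIcc (a i) (b i)) : ℤ) = nbdPartition M a b P := by
  obtain ⟨B, hB, hBX⟩ := exists_isBase_ncard_inter_eq_rk M (⋃ i, cycIcc (a i) (b i))
  have hmatch := hM.exists_tight_perm h hB fun B' hB' =>
    hBX ▸ ncard_isBase_inter_le_rk M hB' _
  obtain ⟨σ, hσ, hnc⟩ := exists_noncrossing_perm
    (fun t r => (B ∩ cycIcc (a t) (b r)).ncard = rk M (cycIcc (a t) (b r)))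
    (fun t t' r r' h1 h2 h3 h4 => by
      obtain ⟨h5, h6⟩ := h.cycIcc_uncross h3 h4
      obtain ⟨h7, h8⟩ := tight_inter_union hB h1 h2
      rw [h5] at h7
      rw [h6] at h8
      exact ⟨h8, h7⟩) hmatch
  refine ⟨orbitPartition σ, isNonCrossing_orbitPartition hnc, ?_⟩
  have hpart : ∀ T ∈ (orbitPartition σ).parts,
      nbd M (restrictBlock a T) (restrictBlock b T) =
        ∑ t ∈ T, ((B ∩ cycIcc (a t) (b t)).ncard : ℤ) := by
    intro T hT
    have : NeZero T.card :=
      ⟨Finset.card_ne_zero.mpr ((orbitPartition σ).nonempty_of_mem_parts hT)⟩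
    rw [(h.restrictBlock T).nbd_eq_of_tight hB, iUnion_restrictBlock, h.ncard_inter_biUnion,
      Nat.cast_sum]
    intro k
    have h1 := hσ (T.orderEmbOfFin rfl (finRotate T.card k))
    rw [apply_orderEmbOfFin_finRotate hnc hT] at h1
    exact h1
  have hsum := Finset.sum_biUnion (f := fun t => ((B ∩ cycIcc (a t) (b t)).ncard : ℤ))
    (orbitPartition σ).disjoint
  rw [(orbitPartition σ).biUnion_parts] at hsum
  rw [nbdPartition, Finset.sum_congr rfl hpart, ← hBX, h.ncard_inter_iUnion, Nat.cast_sum]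
  exact hsum

theorem nbd_restrictBlock_singleton {n s : ℕ} (M : Matroid (Fin n)) (a b : Fin s → Fin n) (i : Fin s) :
    nbd M (restrictBlock a {i}) (restrictBlock b {i}) = rk M (cycIcc (a i) (b i)) := by
  have h1 : ∀ (c : Fin s → Fin n) (k : Fin ({i} : Finset (Fin s)).card),
      restrictBlock c {i} k = c i := by
    intro c k
    rw [restrictBlock, Finset.mem_singleton.1 (Finset.orderEmbOfFin_mem {i} rfl k)]
  have h2 := rk_add_minElts_compl M (cycIcc (a i) (b i))
  simp only [nbd, h1, Finset.sum_const, Finset.card_univ, Fintype.card_fin,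
    Finset.card_singleton, one_smul, cycIoo]
  omega

/-! ### Positions of successors -/

section Successor

variable {n : ℕ} [NeZero n]

theorem val_succ_sub (x z : Fin n) :
    (x + 1 - z).val = if (x - z).val + 1 = n then 0 else (x - z).val + 1 := by
  rw [← val_finRotate (x - z), finRotate_apply, sub_add_eq_add_sub]

theorem val_self_sub_succ (x : Fin n) : (x - (x + 1)).val + 1 = n := by
  have h := val_succ_sub x (x + 1)
  rw [val_sub_self] at h
  split_ifs at h
  assumption

end Successor

/-! ### Grassmann necklaces of positroids without loops and coloops -/

section Necklace

variable {n d : ℕ} [NeZero n] {I : Fin n → Finset (Fin n)} {M : Matroid (Fin n)}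

theorem IsPositroidOf.mem_necklace_self (hM : IsPositroidOf d I M) {i : Fin n}
    (hi : ¬ M.IsLoop i) : i ∈ I i := by
  rw [Matroid.isLoop_iff_forall_mem_compl_isBase] at hi
  push Not at hi
  obtain ⟨B, hB, hiB⟩ := hi
  have hiB' : i ∈ B := by
    by_contra h
    exact hiB ⟨hM.ground_eq ▸ Set.mem_univ i, h⟩
  have h := ((hM.isBase_iff_ncard B).1 hB).2 i i
  have h1 : cycIcc i i = {i} := by
    ext x
    rw [mem_cycIcc_iff, val_sub_self, Set.mem_singleton_iff, Nat.le_zero]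
    exact ⟨fun h => val_sub_inj (h.trans (val_sub_self i).symm), fun h => h ▸ val_sub_self i⟩
  rw [h1, Set.inter_eq_right.mpr (Set.singleton_subset_iff.mpr hiB'), Set.ncard_singleton] at h
  by_contra hi
  rw [Set.inter_singleton_eq_empty.mpr (by simpa using hi), Set.ncard_empty] at h
  omega

theorem IsPositroidOf.notMem_necklace_succ (hM : IsPositroidOf d I M) {i : Fin n}
    (hi : ¬ M.IsLoop i) (hi' : ¬ M.IsColoop i) : i ∉ I (i + 1) := by
  have hself := hM.mem_necklace_self hi
  rw [Matroid.isColoop_iff_forall_mem_isBase] at hi'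
  push Not at hi'
  obtain ⟨B, hB, hiB⟩ := hi'
  obtain ⟨hBd, hBI⟩ := (hM.isBase_iff_ncard B).1 hB
  have hd : 0 < d := by
    rw [← hM.necklace.card_eq i]
    exact Finset.card_pos.2 ⟨i, hself⟩
  obtain ⟨x, hx⟩ : B.Nonempty := by
    rw [← Set.ncard_pos, hBd]
    exact hd
  have hlast := val_self_sub_succ i
  have hxi : (x - (i + 1)).val ≠ (i - (i + 1)).val := fun e => hiB (val_sub_inj e ▸ hx)
  have hxn := (x - (i + 1)).isLt
  -- In the order starting at `i + 1` the element `i` comes last, at position `n - 1`. A basis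
  -- avoiding `i` fits in the positions up to `n - 2`, and the Gale bound then forces `I (i + 1)` to
  -- fit there too.
  obtain ⟨y, hy⟩ := exists_val_sub_eq (i + 1) (show n - 2 < n by omega)
  have hBy : B ∩ cycIcc (i + 1) y = B := by
    rw [Set.inter_eq_left]
    intro z hz
    have hzi : (z - (i + 1)).val ≠ (i - (i + 1)).val := fun e => hiB (val_sub_inj e ▸ hz)
    have hzn := (z - (i + 1)).isLt
    rw [mem_cycIcc_iff]
    omega
  have h := hBI (i + 1) y
  rw [hBy, hBd, ← hM.necklace.card_eq (i + 1), ← Set.ncard_coe_finset] at h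
  have h' := Set.eq_of_subset_of_ncard_le Set.inter_subset_left h
  rw [Set.inter_eq_left] at h'
  intro hmem
  have h'' := h' (Finset.mem_coe.2 hmem)
  rw [mem_cycIcc_iff] at h''
  omega

/-- Every step of the necklace is a proper exchange. -/
theorem IsGrassmannNecklace.exists_step (hI : IsGrassmannNecklace d I)
    (hself : ∀ i, i ∈ I i) (hsucc : ∀ i, i ∉ I (i + 1)) (i : Fin n) :
    ∃ j, j ∉ I i ∧ I (i + 1) = insert j (I i \ {i}) := by
  obtain ⟨j, hj⟩ := hI.step_mem i (hself i)
  refine ⟨j, fun hji => ?_, hj⟩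
  have h1 : j ≠ i := by
    rintro rfl
    exact hsucc j (hj ▸ Finset.mem_insert_self _ _)
  rw [Finset.insert_eq_of_mem (by simp [hji, h1])] at hj
  have h2 := congrArg Finset.card hj
  rw [hI.card_eq, Finset.card_sdiff_of_subset (by simpa using hself i), hI.card_eq,
    Finset.card_singleton] at h2
  have h3 := Finset.card_pos.2 ⟨i, hself i⟩
  rw [hI.card_eq] at h3
  omega

/-- Going around the circle from `j + 1` to `j`, the element `j` stays in the necklace once it
has entered. -/
theorem mem_necklace_of_le {j : Fin n} (hstep : ∀ k, k ≠ j → j ∈ I k → j ∈ I (k + 1))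
    {x y : Fin n} (hxy : (x - (j + 1)).val ≤ (y - (j + 1)).val) (hx : j ∈ I x) : j ∈ I y := by
  obtain ⟨m, hm⟩ := Nat.exists_eq_add_of_le hxy
  clear hxy
  induction m generalizing y with
  | zero => exact val_sub_inj hm ▸ hx
  | succ m ih =>
    have hy := (y - (j + 1)).isLt
    obtain ⟨y', hy'⟩ := exists_val_sub_eq (j + 1)
      (show (x - (j + 1)).val + m < n by omega)
    have h1 := val_succ_sub y' (j + 1)
    rw [if_neg (by omega)] at h1
    have h2 : y = y' + 1 := val_sub_inj (z := j + 1) (by omega)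
    rw [h2]
    refine hstep y' (fun e => ?_) (ih hy')
    subst e
    have h3 := val_self_sub_succ y'
    omega

theorem IsGrassmannNecklace.exists_isAssociatedTo (hI : IsGrassmannNecklace d I)
    (hself : ∀ i, i ∈ I i) (hsucc : ∀ i, i ∉ I (i + 1)) :
    ∃ π : DecoratedPermutation n, π.IsAssociatedTo I := by
  choose f hf hfI using hI.exists_step hself hsucc
  have hstep : ∀ j k, k ≠ j → j ∈ I k → j ∈ I (k + 1) := by
    intro j k hkj hj
    rw [hfI]
    simp [hj, hkj.symm]
  have hfmem : ∀ i, f i ∈ I (i + 1) := fun i => hfI i ▸ Finset.mem_insert_self _ _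
  have hne : ∀ i, f i ≠ i := fun i e => hf i (e.symm ▸ hself i)
  -- `f i` enters at the step from `i` to `i + 1` and can leave only at the step from `f i` to `f i
  -- + 1`. This determines `i` from `f i`, whence injectivity.
  have hmem : ∀ i k, f i ∈ I k ↔ (i - (f i + 1)).val < (k - (f i + 1)).val := by
    intro i k
    constructor
    · intro h
      by_contra! hle
      exact hf i (mem_necklace_of_le (hstep _) hle h)
    · intro h
      refine mem_necklace_of_le (hstep _) ?_ (hfmem i)
      have h1 := val_succ_sub i (f i + 1)
      split_ifs at h1 <;> omega
  have hinj : Function.Injective f := by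
    intro i i' h
    have h1 := hmem i i'
    have h2 := hmem i' i
    rw [h] at h1
    rw [← h] at h2
    have h3 := hf i
    have h4 := hf i'
    rw [h] at h2 h3
    exact val_sub_inj (z := f i' + 1) (by simp only [h3, h4, false_iff] at h1 h2; omega)
  refine ⟨⟨Equiv.ofBijective f (Finite.injective_iff_bijective.1 hinj), ∅, by simp⟩, ?_⟩
  intro k j
  obtain ⟨i, rfl⟩ := (Finite.injective_iff_surjective.1 hinj) j
  have h1 : (Equiv.ofBijective f (Finite.injective_iff_bijective.1 hinj)).symm (f i) = i :=
    Equiv.ofBijective_symm_apply_apply f _ i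
  rw [hmem, DecoratedPermutation.IsWeakExceedance, h1]
  change _ ↔ (f i - k).val < (i - k).val ∨ f i ∈ (∅ : Set (Fin n))
  have h2 := val_self_sub_succ (f i)
  have h3 := (i - (f i + 1)).isLt
  have h4 := (k - (f i + 1)).isLt
  have h5 : (i - (f i + 1)).val ≠ (f i - (f i + 1)).val := fun e => hne i (val_sub_inj e).symm
  rw [val_sub_rebase (f i + 1) (f i) k, val_sub_rebase (f i + 1) i k, Set.mem_empty_iff_false,
    or_false]
  split_ifs <;> omega

section Associated

variable {π : DecoratedPermutation n}

theorem DecoratedPermutation.IsAssociatedTo.perm_ne (hπ : π.IsAssociatedTo I)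
    (hself : ∀ i, i ∈ I i) (hsucc : ∀ i, i ∉ I (i + 1)) (x : Fin n) : π.perm x ≠ x := by
  intro hx
  have hx' : π.perm.symm x = x := by rw [Equiv.symm_apply_eq, hx]
  have h1 := (hπ x x).1 (hself x)
  rw [IsWeakExceedance, hx'] at h1
  rcases h1 with h1 | h1
  · exact lt_irrefl _ h1
  · exact hsucc x ((hπ (x + 1) x).2 (Or.inr h1))

theorem DecoratedPermutation.IsAssociatedTo.mem_iff (hπ : π.IsAssociatedTo I)
    (hself : ∀ i, i ∈ I i) (hsucc : ∀ i, i ∉ I (i + 1)) (k j : Fin n) :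
    j ∈ I k ↔ (j - k).val < (π.perm.symm j - k).val := by
  rw [hπ k j, IsWeakExceedance, or_iff_left]
  · rfl
  · exact fun h => hπ.perm_ne hself hsucc j (π.perm_eq_of_mem_black j h)

theorem DecoratedPermutation.IsAssociatedTo.unique (hI : IsGrassmannNecklace d I)
    (hself : ∀ i, i ∈ I i) (hsucc : ∀ i, i ∉ I (i + 1)) {π π' : DecoratedPermutation n}
    (hπ : π.IsAssociatedTo I) (hπ' : π'.IsAssociatedTo I) : π = π' := by
  have hblack : ∀ {ρ : DecoratedPermutation n}, ρ.IsAssociatedTo I → ρ.black = ∅ := by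
    intro ρ hρ
    rw [Set.eq_empty_iff_forall_notMem]
    exact fun x hx => hρ.perm_ne hself hsucc x (ρ.perm_eq_of_mem_black x hx)
  have hstep : ∀ i j, j ∉ I i → I (i + 1) = insert j (I i \ {i}) →
      ∀ {ρ : DecoratedPermutation n}, ρ.IsAssociatedTo I → ρ.perm i = j := by
    intro i j hj hij ρ hρ
    have h1 : ρ.perm i ∉ I i := by
      rw [hρ.mem_iff hself hsucc, Equiv.symm_apply_apply, val_sub_self]
      omega
    have h2 : ρ.perm i ∈ I (i + 1) := by
      rw [hρ.mem_iff hself hsucc, Equiv.symm_apply_apply]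
      have h3 := val_self_sub_succ i
      have h4 := (ρ.perm i - (i + 1)).isLt
      have h5 : (ρ.perm i - (i + 1)).val ≠ (i - (i + 1)).val := fun e =>
        hρ.perm_ne hself hsucc i (val_sub_inj e)
      omega
    rw [hij] at h2
    simpa [h1] using h2
  have hperm : π.perm = π'.perm := by
    ext i : 1
    obtain ⟨j, hj, hij⟩ := hI.exists_step hself hsucc i
    rw [hstep i j hj hij hπ, hstep i j hj hij hπ']
  have hb : π.black = π'.black := by rw [hblack hπ, hblack hπ']
  cases π
  cases π'
  cases hperm
  cases hb
  rfl

/-- The open interval `(b, a)` contains the CCW-arrows starting at its elements in `I a`. -/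
theorem DecoratedPermutation.IsAssociatedTo.ccw_cycIoo (hπ : π.IsAssociatedTo I)
    (hself : ∀ i, i ∈ I i) (hsucc : ∀ i, i ∉ I (i + 1)) (a b : Fin n) :
    π.ccw (cycIoo b a) = ((I a : Set (Fin n)) ∩ cycIoo b a).ncard := by
  rw [ccw]
  congr 1
  ext x
  have hne : π.perm.symm x ≠ x := fun h =>
    hπ.perm_ne hself hsucc x (by rw [Equiv.symm_apply_eq] at h; exact h.symm)
  rw [Set.mem_ofPred_eq, Set.mem_inter_iff, Finset.mem_coe, hπ.mem_iff hself hsucc,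
    mem_cycIoo_iff]
  have hne' : (π.perm.symm x - a).val ≠ (x - a).val := fun h => hne (val_sub_inj h)
  have haa := val_sub_self a
  constructor
  · intro h
    have h1 : x ∈ cycIoo b a := h (by
      rw [mem_cycIcc_iff, val_sub_self]
      exact Nat.zero_le _)
    -- In the order from `a`, `(b, a)` is a final segment: an arrow starting in it stays inside
    -- exactly when it does not pass `a`.
    have h2 : a ∉ cycIcc x (π.perm.symm x) := fun h3 => by
      have h4 := h h3
      rw [mem_cycIoo_iff] at h4
      omega
    rw [mem_cycIoo_iff] at h1
    rw [mem_cycIcc_iff_rebase a] at h2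
    split_ifs at h2 <;> omega
  · rintro ⟨h1, h2⟩ y hy
    rw [mem_cycIcc_iff_rebase a, if_pos h1.le] at hy
    rw [mem_cycIoo_iff]
    omega

theorem DecoratedPermutation.IsAssociatedTo.cw_cycIcc (hπ : π.IsAssociatedTo I)
    (hself : ∀ i, i ∈ I i) (hsucc : ∀ i, i ∉ I (i + 1)) {a b : Fin n}
    (hab : cycIcc a b ≠ Set.univ) :
    π.cw (cycIcc a b) = (cycIcc a b \ (I a : Set (Fin n))).ncard := by
  -- CW-arrows are counted by their heads `y = π x`. Properness of `[a, b]` supplies a point `z`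
  -- outside, which excludes arrows wrapping around past `a`.
  rw [cw, ← Set.ncard_image_of_injective _ π.perm.injective]
  congr 1
  obtain ⟨z, hz⟩ := (Set.ne_univ_iff_exists_notMem _).1 hab
  rw [mem_cycIcc_iff] at hz
  ext y
  rw [Equiv.image_eq_preimage_symm, Set.mem_preimage, Set.mem_ofPred_eq, Equiv.apply_symm_apply,
    Set.mem_sdiff, Finset.mem_coe, hπ.mem_iff hself hsucc, mem_cycIcc_iff]
  constructor
  · intro h
    have h1 : π.perm.symm y ∈ cycIcc a b := h (by
      rw [mem_cycIcc_iff, val_sub_self]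
      exact Nat.zero_le _)
    have h2 : y ∈ cycIcc a b := h (by rw [mem_cycIcc_iff])
    have h3 : z ∉ cycIcc (π.perm.symm y) y := fun h3 => hz (h h3)
    rw [mem_cycIcc_iff] at h1 h2
    rw [mem_cycIcc_iff_rebase a] at h3
    split_ifs at h3 <;> omega
  · rintro ⟨h1, h2⟩ x hx
    rw [mem_cycIcc_iff_rebase a, if_pos (not_lt.1 h2)] at hx
    rw [mem_cycIcc_iff]
    omega

end Associated

theorem IsGrassmannNecklace.ncard_succ_inter_le (hI : IsGrassmannNecklace d I)
    (hself : ∀ i, i ∈ I i) {k : Fin n} {X : Set (Fin n)} (hk : k ∈ X) :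
    ((I (k + 1) : Set (Fin n)) ∩ X).ncard ≤ ((I k : Set (Fin n)) ∩ X).ncard := by
  obtain ⟨j, hj⟩ := hI.step_mem k (hself k)
  have h1 : (I (k + 1) : Set (Fin n)) ∩ X ⊆ insert j (((I k : Set (Fin n)) ∩ X) \ {k}) := by
    rintro x ⟨hx, hxX⟩
    rw [hj] at hx
    simp only [Finset.coe_insert, Finset.coe_sdiff, Finset.coe_singleton] at hx
    rcases hx with hx | hx
    · exact Or.inl hx
    · exact Or.inr ⟨⟨hx.1, hxX⟩, hx.2⟩
  refine (Set.ncard_le_ncard h1).trans ((Set.ncard_insert_le _ _).trans ?_)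
  have h2 : k ∈ (I k : Set (Fin n)) ∩ X := ⟨Finset.mem_coe.2 (hself k), hk⟩
  exact (Set.ncard_sdiff_singleton_add_one h2).le

theorem IsGrassmannNecklace.ncard_inter_le_succ (hI : IsGrassmannNecklace d I)
    (hself : ∀ i, i ∈ I i) {k : Fin n} {X : Set (Fin n)} (hk : k ∉ X) :
    ((I k : Set (Fin n)) ∩ X).ncard ≤ ((I (k + 1) : Set (Fin n)) ∩ X).ncard := by
  obtain ⟨j, hj⟩ := hI.step_mem k (hself k)
  refine Set.ncard_le_ncard ?_
  rintro x ⟨hx, hxX⟩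
  refine ⟨?_, hxX⟩
  have hxk : x ≠ k := fun e => hk (e ▸ hxX)
  rw [hj]
  simpa [hxk] using Or.inr hx

/-- The counts `|I k ∩ [j, x]|` are maximal for `k = j`. -/
theorem IsGrassmannNecklace.ncard_inter_cycIcc_le (hI : IsGrassmannNecklace d I)
    (hself : ∀ i, i ∈ I i) (k j x : Fin n) :
    ((I k : Set (Fin n)) ∩ cycIcc j x).ncard ≤ ((I j : Set (Fin n)) ∩ cycIcc j x).ncard := by
  -- Walking from `j`, a step at `k ∈ [j, x]` removes an element of the interval, so the count does
  -- not grow; a step outside removes none, so it does not drop before the return to `j`.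
  have hup : ∀ m, m ≤ (x - j).val → ∀ k : Fin n, (k - j).val = m →
      ((I k : Set (Fin n)) ∩ cycIcc j x).ncard ≤ ((I j : Set (Fin n)) ∩ cycIcc j x).ncard := by
    intro m
    induction m with
    | zero =>
      intro _ k hk
      rw [val_sub_inj (hk.trans (val_sub_self j).symm)]
    | succ m ih =>
      intro hm k hk
      have hxj := (x - j).isLt
      obtain ⟨k', hk'⟩ := exists_val_sub_eq j (show m < n by omega)
      have h1 := val_succ_sub k' j
      rw [if_neg (by omega)] at h1
      rw [show k = k' + 1 from val_sub_inj (z := j) (by omega)]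
      exact (hI.ncard_succ_inter_le hself (by rw [mem_cycIcc_iff]; omega)).trans
        (ih (by omega) k' hk')
  have hdown : ∀ r, ∀ k : Fin n, (x - j).val < (k - j).val → (k - j).val + r + 1 = n →
      ((I k : Set (Fin n)) ∩ cycIcc j x).ncard ≤ ((I j : Set (Fin n)) ∩ cycIcc j x).ncard := by
    intro r
    induction r with
    | zero =>
      intro k hxk hk
      refine (hI.ncard_inter_le_succ hself (by rw [mem_cycIcc_iff]; omega)).trans ?_
      have h1 := val_succ_sub k j
      rw [if_pos (by omega)] at h1
      rw [val_sub_inj (h1.trans (val_sub_self j).symm)]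
    | succ r ih =>
      intro k hxk hk
      refine (hI.ncard_inter_le_succ hself (by rw [mem_cycIcc_iff]; omega)).trans ?_
      have h1 := val_succ_sub k j
      rw [if_neg (by omega)] at h1
      exact ih (k + 1) (by omega) (by omega)
  rcases le_or_gt (k - j).val (x - j).val with h | h
  · exact hup _ h k rfl
  · have hk := (k - j).isLt
    exact hdown (n - 1 - (k - j).val) k h (by omega)

theorem IsPositroidOf.isBase_necklace (hM : IsPositroidOf d I M) (hself : ∀ i, i ∈ I i)
    (k : Fin n) : M.IsBase (I k : Set (Fin n)) := by
  rw [hM.isBase_iff_ncard, Set.ncard_coe_finset]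
  exact ⟨hM.necklace.card_eq k, hM.necklace.ncard_inter_cycIcc_le hself k⟩

/-- The Gale bound for `I a` is an upper bound for every basis, and `I a`, itself a basis, attains
it. -/
theorem IsPositroidOf.rk_cycIcc (hM : IsPositroidOf d I M) (hself : ∀ i, i ∈ I i)
    (a b : Fin n) : rk M (cycIcc a b) = ((I a : Set (Fin n)) ∩ cycIcc a b).ncard := by
  refine le_antisymm ?_ (ncard_isBase_inter_le_rk M (hM.isBase_necklace hself a) _)
  obtain ⟨B, hB, h⟩ := exists_isBase_ncard_inter_eq_rk M (cycIcc a b)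
  rw [← h]
  exact ((hM.isBase_iff_ncard B).1 hB).2 a b

theorem IsPositroidOf.minElts_cycIoo (hM : IsPositroidOf d I M) (hself : ∀ i, i ∈ I i)
    (a b : Fin n) : minElts M (cycIoo b a) = ((I a : Set (Fin n)) ∩ cycIoo b a).ncard := by
  have h1 := rk_add_minElts_compl M (cycIcc a b)
  have h2 := ncard_inter_add_ncard_inter_compl (I a : Set (Fin n)) (cycIcc a b)
  rw [ncard_eq_rk_ground (hM.isBase_necklace hself a)] at h2
  rw [hM.rk_cycIcc hself] at h1
  rw [cycIoo]
  omega

end Necklace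

end Positroid

/-! ### The main theorem -/

theorem mainTheorem1 (n : ℕ) [NeZero n] (d : ℕ) (I : Fin n → Finset (Fin n))
    (M : Matroid (Fin n)) (hM : Positroid.IsPositroidOf d I M)
    (hloop : ∀ e, ¬ M.IsLoop e) (hcoloop : ∀ e, ¬ M.IsColoop e)
    (s : ℕ) (a b : Fin s → Fin n) (hab : Positroid.CyclicallyOrdered a b) :
    -- the bound given by some non-crossing partition is attained
    (∃ P : Finpartition (Finset.univ : Finset (Fin s)), Positroid.IsNonCrossing P ∧
      (Positroid.rk M (⋃ i, Positroid.cycIcc (a i) (b i)) : ℤ) =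
        Positroid.nbdPartition M a b P) ∧
    -- the rank is the minimum of the bounds over all non-crossing partitions
    IsLeast {k : ℤ | ∃ P : Finpartition (Finset.univ : Finset (Fin s)),
        Positroid.IsNonCrossing P ∧ Positroid.nbdPartition M a b P = k}
      (Positroid.rk M (⋃ i, Positroid.cycIcc (a i) (b i)) : ℤ) ∧
    -- the bounds are given by arrow counts of the decorated permutation
    (∃! π : Positroid.DecoratedPermutation n, π.IsAssociatedTo I) ∧
    ∀ π : Positroid.DecoratedPermutation n, π.IsAssociatedTo I →
      (∀ x, π.perm x ≠ x) ∧
      (∀ T : Finset (Fin s), T.Nonempty →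
        Positroid.nbd M (Positroid.restrictBlock a T) (Positroid.restrictBlock b T) =
          (Positroid.rk M M.E : ℤ) - ∑ i : Fin T.card,
            (π.ccw (Positroid.cycIoo (Positroid.restrictBlock b T i)
              (Positroid.restrictBlock a T (finRotate T.card i))) : ℤ)) ∧
      (∀ i : Fin s, Positroid.cycIcc (a i) (b i) ≠ Set.univ →
        Positroid.nbd M (Positroid.restrictBlock a {i}) (Positroid.restrictBlock b {i}) =
          ((Positroid.cycIcc (a i) (b i)).ncard : ℤ) -
            (π.cw (Positroid.cycIcc (a i) (b i)) : ℤ)) := by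
  have hself : ∀ i, i ∈ I i := fun i => hM.mem_necklace_self (hloop i)
  have hsucc : ∀ i, i ∉ I (i + 1) := fun i => hM.notMem_necklace_succ (hloop i) (hcoloop i)
  obtain ⟨P, hP, hrk⟩ := hM.exists_isNonCrossing_rk_eq hab
  refine ⟨⟨P, hP, hrk⟩, ⟨⟨P, hP, hrk.symm⟩, ?_⟩, ?_, fun π hπ => ⟨hπ.perm_ne hself hsucc, ?_, ?_⟩⟩
  · rintro k ⟨Q, -, rfl⟩
    exact hab.rk_le_nbdPartition Q
  · obtain ⟨π, hπ⟩ := hM.necklace.exists_isAssociatedTo hself hsucc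
    exact ⟨π, hπ, fun π' hπ' => hπ'.unique hM.necklace hself hsucc hπ⟩
  · intro T _
    simp only [Positroid.nbd, hM.minElts_cycIoo hself, hπ.ccw_cycIoo hself hsucc]
  · intro i hi
    rw [Positroid.nbd_restrictBlock_singleton, hM.rk_cycIcc hself, hπ.cw_cycIcc hself hsucc hi]
    have h := Set.ncard_inter_add_ncard_sdiff_eq_ncard (Positroid.cycIcc (a i) (b i))
      (I (a i) : Set (Fin n))
    rw [Set.inter_comm] at h
    omega
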